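/- For integers $s\ge 2$, $n\ge 0$, a graph $H$ and a real number $f$, let $\alpha_s(G)$ denote the maximum number of vertices in a $K_s$-free induced subgraph of a finite graph $G$, and let $\mathbf{RT}_s(n,H,f)$ be the maximum number of edges in an $H$-free graph $G$ on $n$ vertices with $\alpha_s(G)<f$ (and $0$ if no such graph exists). Let $s\ge 2$ be an integer and let $\delta\in\{3/5,\,5/8,\,2/3,\,5/7,\,3/4\}$. Then $$\mathbf{RT}_s\big(n,K_{s+1},\Theta(n^{\delta})\big)=\Theta\big(n^{1+\delta}\big),$$ in the following sense. There are constants $C_0>0$, $a>0$ and $n_0$, depending only on $s$ and $\delta$, such that for every $C_1\ge C_0$ there is a constant $b>0$, depending only on $s$, $\delta$ and $C_1$, such that for all integers $n\ge n_0$ and all real $f$ with $C_0n^{\delta}\le f\le C_1n^{\delta}$, $$a\,n^{1+\delta}\;\le\;\mathbf{RT}_s(n,K_{s+1},f)\;\le\; b\,n^{1+\delta}.$$ -/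

import Mathlib

/-- The `s`-independence number `α_s(G)` of a finite graph: the maximum number of vertices in a
`K_s`-free induced subgraph of `G`. -/
noncomputable def sIndepNum {V : Type*} [Fintype V] (s : ℕ) (G : SimpleGraph V) : ℕ :=
  sSup {k : ℕ | ∃ S : Finset V, (G.induce (S : Set V)).CliqueFree s ∧ S.card = k}

/-- The Ramsey–Turán number `RT_s(n, H, f)`: the maximum number of edges in an `H`-free graph `G`
on `n` vertices with `α_s(G) < f`. `H`-free means that `G` has no (not necessarily induced)
subgraph isomorphic to `H`. The set below is finite, so the supremum is a maximum as soon as the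
set is non-empty, and it is `0` if there is no such graph. -/
noncomputable def ramseyTuran {W : Type*} (s n : ℕ) (H : SimpleGraph W) (f : ℝ) : ℕ :=
  sSup {m : ℕ | ∃ G : SimpleGraph (Fin n),
    H.Free G ∧ (sIndepNum s G : ℝ) < f ∧ G.edgeSet.ncard = m}

/-! The upper bound is elementary: in a `K_{s+1}`-free graph every neighbourhood is `K_s`-free, so
all degrees are at most `α_s < f` and there are at most `n * f` edges.

For the lower bound, take a triangle-free partial linear space with `k` points on a line, `r` lines
through a point and `N = k ^ 2 * r` points. Colour each line's points at random with `s` colours,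
independently for each line, and join two points of a line when their colours differ. Three mutually
adjacent points are collinear, so a clique lies on a single line and has at most `s` vertices. A
union bound shows that, with positive probability, every set of `m = 4 * s ^ 2 * k * r` points shows
all `s` colours on some line, hence contains a `K_s`, while a constant proportion of the roughly `k
^ 3 * r ^ 2` collinear pairs become edges.

With `k = q ^ α` and `r = q ^ β` this gives `N = q ^ (2α + β)`, `α_s = O(N ^ δ)` and order of `N ^
(1 + δ)` edges, where `δ = (α + β) / (2α + β)`. The five exponents come from `(α, β) = (2,1), (3,2),
(1,1), (2,3), (1,2)`, realised by a conic, an elliptic quadric, a Hermitian variety, and the duals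
of the last two. A bounded blow-up passes from `N` to every large `n`. -/

/-! ### Affine quadrangles and parallel classes -/

/-- A finite partial linear space without triangles of the size of the affine part of a
generalized quadrangle: lines have `k` points, points lie on `r` lines, there are `k ^ 2 * r`
points and `k * r ^ 2` lines, and the incidence graph has no cycles of length four or six. -/
structure IsAffineQuadrangle {P L : Type} [Fintype P] [Fintype L] (I : P → L → Prop)
    (k r : ℕ) : Prop where
  card_points : Fintype.card P = k ^ 2 * r
  card_lines : Fintype.card L = k * r ^ 2
  card_on_line : ∀ l, Nat.card {p // I p l} = k
  card_through_point : ∀ p, Nat.card {l // I p l} = r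
  linear : ∀ p p' l l', I p l → I p' l → I p l' → I p' l' → p = p' ∨ l = l'
  triangle_free : ∀ p₁ p₂ p₃ l₁ l₂ l₃, I p₁ l₁ → I p₂ l₁ → I p₂ l₂ → I p₃ l₂ → I p₃ l₃ → I p₁ l₃ →
    p₁ = p₂ ∨ p₂ = p₃ ∨ p₃ = p₁ ∨ l₁ = l₂ ∨ l₂ = l₃ ∨ l₃ = l₁

/-- The axioms are symmetric in points and lines, so a family with `k ≠ r` yields two exponents. -/
theorem IsAffineQuadrangle.dual {P L : Type} [Fintype P] [Fintype L] {I : P → L → Prop}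
    {k r : ℕ} (h : IsAffineQuadrangle I k r) : IsAffineQuadrangle (fun l p => I p l) r k where
  card_points := by rw [h.card_lines]; ring
  card_lines := by rw [h.card_points]; ring
  card_on_line := h.card_through_point
  card_through_point := h.card_on_line
  linear l l' p p' h₁ h₂ h₃ h₄ := (h.linear p p' l l' h₁ h₃ h₂ h₄).symm
  triangle_free l₁ l₂ l₃ p₁ p₂ p₃ h₁ h₂ h₃ h₄ h₅ h₆ := by
    have := h.triangle_free p₁ p₂ p₃ l₂ l₃ l₁ h₂ h₃ h₄ h₅ h₆ h₁
    tauto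

/-- There is an affine quadrangle with lines of size `k` and points of degree `r`. -/
def ExistsAffineQuadrangle (k r : ℕ) : Prop :=
  ∃ (P L : Type) (_ : Fintype P) (_ : Fintype L) (I : P → L → Prop), IsAffineQuadrangle I k r

theorem ExistsAffineQuadrangle.dual {k r : ℕ} (h : ExistsAffineQuadrangle k r) :
    ExistsAffineQuadrangle r k := by
  obtain ⟨P, L, _, _, I, hI⟩ := h
  exact ⟨L, P, _, _, _, hI.dual⟩

/-- Affine quadrangles from parallel classes of lines: the points are the pairs `(t, v)`, and the
lines of the parallel class `d` are the fibres of the map `(t, v) ↦ π d t v`. -/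
theorem ExistsAffineQuadrangle.of_parallel_classes {T D Q : Type} [Fintype T] [Fintype D]
    [Fintype Q] (π : D → T → Q → Q) (hQ : Fintype.card Q = Fintype.card T * Fintype.card D)
    (inj : ∀ d t, Function.Injective (π d t))
    (linear : ∀ d d' t t' v v', π d t v = π d t' v' → π d' t v = π d' t' v' →
      t = t' ∨ d = d')
    (triangle_free : ∀ d₁ d₂ d₃ t₁ t₂ t₃ v₁ v₂ v₃, π d₁ t₁ v₁ = π d₁ t₂ v₂ →
      π d₂ t₂ v₂ = π d₂ t₃ v₃ → π d₃ t₃ v₃ = π d₃ t₁ v₁ →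
      t₁ = t₂ ∨ t₂ = t₃ ∨ t₃ = t₁ ∨ d₁ = d₂ ∨ d₂ = d₃ ∨ d₃ = d₁) :
    ExistsAffineQuadrangle (Fintype.card T) (Fintype.card D) := by
  have key : ∀ d t t' v v', π d t v = π d t' v' → t = t' → (t, v) = (t', v') := by
    rintro d t t' v v' h rfl
    rw [inj d t h]
  refine ⟨T × Q, D × Q, inferInstance, inferInstance, fun p l => π l.1 p.1 p.2 = l.2, ?_⟩
  refine ⟨?_, ?_, ?_, ?_, ?_, ?_⟩
  · rw [Fintype.card_prod, hQ]; ring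
  · rw [Fintype.card_prod, hQ]; ring
  -- An injective `π d t` on the finite set `Q` is bijective, so every line meets every slice `{t} ×
  -- Q` exactly once.
  · rintro ⟨d, c⟩
    rw [← Nat.card_eq_fintype_card]
    refine Nat.card_eq_of_bijective (fun p => p.1.1) ⟨?_, ?_⟩
    · rintro ⟨⟨t, v⟩, h⟩ ⟨⟨t', v'⟩, h'⟩ heq
      exact Subtype.ext (key d t t' v v' (h.trans h'.symm) heq)
    · intro t
      obtain ⟨v, hv⟩ := (Finite.injective_iff_surjective.1 (inj d t)) c
      exact ⟨⟨(t, v), hv⟩, rfl⟩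
  · rintro ⟨t, v⟩
    rw [← Nat.card_eq_fintype_card]
    refine Nat.card_eq_of_bijective (fun l => l.1.1) ⟨?_, ?_⟩
    · rintro ⟨⟨d, c⟩, h⟩ ⟨⟨d', c'⟩, h'⟩ heq
      simp only at h h' heq
      subst heq
      exact Subtype.ext (Prod.ext rfl (h.symm.trans h'))
    · intro d
      exact ⟨⟨(d, π d t v), rfl⟩, rfl⟩
  · rintro ⟨t, v⟩ ⟨t', v'⟩ ⟨d, c⟩ ⟨d', c'⟩ h₁ h₂ h₃ h₄
    simp only at h₁ h₂ h₃ h₄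
    rcases linear d d' t t' v v' (h₁.trans h₂.symm) (h₃.trans h₄.symm) with h | h
    · exact Or.inl (key d t t' v v' (h₁.trans h₂.symm) h)
    · subst h
      exact Or.inr (Prod.ext rfl (h₁.symm.trans h₃))
  · rintro ⟨t₁, v₁⟩ ⟨t₂, v₂⟩ ⟨t₃, v₃⟩ ⟨d₁, c₁⟩ ⟨d₂, c₂⟩ ⟨d₃, c₃⟩ h₁ h₂ h₃ h₄ h₅ h₆
    simp only at h₁ h₂ h₃ h₄ h₅ h₆
    have e₁ := h₁.trans h₂.symm
    have e₂ := h₃.trans h₄.symm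
    have e₃ := h₅.trans h₆.symm
    rcases triangle_free d₁ d₂ d₃ t₁ t₂ t₃ v₁ v₂ v₃ e₁ e₂ e₃ with h | h | h | h | h | h
    · exact Or.inl (key _ _ _ _ _ e₁ h)
    · exact Or.inr (Or.inl (key _ _ _ _ _ e₂ h))
    · exact Or.inr (Or.inr (Or.inl (key _ _ _ _ _ e₃ h)))
    · subst h
      exact Or.inr (Or.inr (Or.inr (Or.inl (Prod.ext rfl (h₂.symm.trans h₃)))))
    · subst h
      exact Or.inr (Or.inr (Or.inr (Or.inr (Or.inl (Prod.ext rfl (h₄.symm.trans h₅))))))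
    · subst h
      exact Or.inr (Or.inr (Or.inr (Or.inr (Or.inr (Prod.ext rfl (h₆.symm.trans h₁))))))

/-! ### Identities for the Hermitian quadrangle -/

/-- The last line coordinate is designed so that, for two points of one line, the difference of the
`z` coordinates is an alternating form in their other coordinates, with no reference to the
direction of the line. -/
theorem collinear_of_hermitian_line {K : Type*} [Field K]
    {a a' b t t' x x' y y' z u u' v v' w w' c : K}
    (h₁ : x - (t * a - t' * a') = v - (u * a - u' * a'))
    (h₂ : x' - (t * a' + t' * a) = v' - (u * a' + u' * a))
    (h₃ : y - (-t * (a ^ 2 + a' ^ 2) - t' * b) = w - (-u * (a ^ 2 + a' ^ 2) - u' * b))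
    (h₄ : y' - (t * b - t' * (a ^ 2 + a' ^ 2)) = w' - (u * b - u' * (a ^ 2 + a' ^ 2)))
    (h₅ : z - (t' * (-t * (a ^ 2 + a' ^ 2) - t' * b) - t * (t * b - t' * (a ^ 2 + a' ^ 2))
        + (y' * t - y * t') + 2 * (x' * (t * a - t' * a') - x * (t * a' + t' * a)))
      = c - (u' * (-u * (a ^ 2 + a' ^ 2) - u' * b) - u * (u * b - u' * (a ^ 2 + a' ^ 2))
        + (w' * u - w * u') + 2 * (v' * (u * a - u' * a') - v * (u * a' + u' * a)))) :
    z - c = u' * y - u * y' + (w' * t - w * t') + 2 * (v' * x - v * x') := by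
  obtain rfl : x = v + ((t - u) * a - (t' - u') * a') := by linear_combination h₁
  obtain rfl : x' = v' + ((t - u) * a' + (t' - u') * a) := by linear_combination h₂
  obtain rfl : y = w + (-(t - u) * (a ^ 2 + a' ^ 2) - (t' - u') * b) := by
    linear_combination h₃
  obtain rfl : y' = w' + ((t - u) * b - (t' - u') * (a ^ 2 + a' ^ 2)) := by
    linear_combination h₄
  linear_combination h₅

/-- In complex notation let `σ = s + i s'`, `ω = w + i w'`, `A = a + i a'`, `C = c + i c'` and `Δ =
|A - C|² + i (b - d + 2 Im(A C̄))`. Then `h₅` says that the imaginary part of `σ̄ ω Δ` vanishes, and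
eliminating the third direction gives `h₆`, the vanishing of its real part. Anisotropy of the norm
then forces one factor to be zero, and `Δ = 0` means that the first two directions agree. -/
theorem hermitian_directions_eq {K : Type*} [Field K]
    (aniso : ∀ x y : K, x ^ 2 + y ^ 2 = 0 → x = 0 ∧ y = 0)
    {s s' w w' a a' b c c' d e e' f : K}
    (h₁ : s * a - s' * a' + (w * c - w' * c') = (s + w) * e - (s' + w') * e')
    (h₂ : s * a' + s' * a + (w * c' + w' * c) = (s + w) * e' + (s' + w') * e)
    (h₃ : -s * (a ^ 2 + a' ^ 2) - s' * b + (-w * (c ^ 2 + c' ^ 2) - w' * d)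
      = -(s + w) * (e ^ 2 + e' ^ 2) - (s' + w') * f)
    (h₄ : s * b - s' * (a ^ 2 + a' ^ 2) + (w * d - w' * (c ^ 2 + c' ^ 2))
      = (s + w) * f - (s' + w') * (e ^ 2 + e' ^ 2))
    (h₅ : (s * w + s' * w') * (b - d + 2 * (a' * c - a * c'))
      - (s' * w - s * w') * ((a - c) ^ 2 + (a' - c') ^ 2) = 0) :
    (s = 0 ∧ s' = 0) ∨ (w = 0 ∧ w' = 0) ∨ (a = c ∧ a' = c' ∧ b = d) := by
  have h₆ : -(s * w + s' * w') * ((a - c) ^ 2 + (a' - c') ^ 2)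
      - (s' * w - s * w') * (b - d + 2 * (a' * c - a * c')) = 0 := by
    linear_combination (s + w) * h₃ + (s' + w') * h₄
      + (s * a - s' * a' + (w * c - w' * c') + ((s + w) * e - (s' + w') * e')) * h₁
      + (s * a' + s' * a + (w * c' + w' * c) + ((s + w) * e' + (s' + w') * e)) * h₂
  have h₇ : (s ^ 2 + s' ^ 2) * (w ^ 2 + w' ^ 2) * ((a - c) ^ 2 + (a' - c') ^ 2) = 0 := by
    linear_combination -(s * w + s' * w') * h₆ - (s' * w - s * w') * h₅
  have h₈ : (s ^ 2 + s' ^ 2) * (w ^ 2 + w' ^ 2) * (b - d + 2 * (a' * c - a * c')) = 0 := by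
    linear_combination -(s' * w - s * w') * h₆ + (s * w + s' * w') * h₅
  by_cases hs : s ^ 2 + s' ^ 2 = 0
  · exact Or.inl (aniso _ _ hs)
  by_cases hw : w ^ 2 + w' ^ 2 = 0
  · exact Or.inr (Or.inl (aniso _ _ hw))
  simp only [mul_eq_zero, hs, hw, false_or] at h₇ h₈
  obtain ⟨ha, ha'⟩ := aniso _ _ h₇
  obtain rfl := sub_eq_zero.1 ha
  obtain rfl := sub_eq_zero.1 ha'
  exact Or.inr (Or.inr ⟨rfl, rfl, by linear_combination h₈⟩)

/-! ### Three families of quadrangles over a finite field -/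

section Constructions

variable {K : Type} [Field K] [Fintype K]

/-- The conic `(1, a, a ^ 2)` at infinity. -/
theorem existsAffineQuadrangle_conic :
    ExistsAffineQuadrangle (Fintype.card K) (Fintype.card K) := by
  refine ExistsAffineQuadrangle.of_parallel_classes (T := K) (D := K) (Q := K × K)
    (fun a t v => (v.1 - t * a, v.2 - t * a ^ 2)) (by simp) ?_ ?_ ?_
  · rintro a t ⟨x, y⟩ ⟨x', y'⟩ h
    simpa using h
  · rintro a b t t' ⟨x, y⟩ ⟨x', y'⟩ h₁ h₂
    simp only [Prod.mk.injEq] at h₁ h₂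
    have : (t - t') * (a - b) = 0 := by linear_combination h₂.1 - h₁.1
    simpa [sub_eq_zero] using this
  · rintro a b c t₁ t₂ t₃ ⟨x₁, y₁⟩ ⟨x₂, y₂⟩ ⟨x₃, y₃⟩ h₁ h₂ h₃
    simp only [Prod.mk.injEq] at h₁ h₂ h₃
    have e₁ : (t₁ - t₂) * a + (t₂ - t₃) * b + (t₃ - t₁) * c = 0 := by
      linear_combination -h₁.1 - h₂.1 - h₃.1
    have e₂ : (t₁ - t₂) * a ^ 2 + (t₂ - t₃) * b ^ 2 + (t₃ - t₁) * c ^ 2 = 0 := by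
      linear_combination -h₁.2 - h₂.2 - h₃.2
    -- The three coefficients also sum to zero, so this is a Vandermonde elimination: no three
    -- points of the conic are collinear.
    have : (t₁ - t₂) * ((a - b) * (c - a)) = 0 := by
      linear_combination (b + c) * e₁ - e₂
    simp only [mul_eq_zero, sub_eq_zero] at this
    tauto

/-- The elliptic quadric `(1, a, b, a ^ 2 + b ^ 2)` at infinity. -/
theorem existsAffineQuadrangle_quadric
    (aniso : ∀ x y : K, x ^ 2 + y ^ 2 = 0 → x = 0 ∧ y = 0) :
    ExistsAffineQuadrangle (Fintype.card K) (Fintype.card K ^ 2) := by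
  have := ExistsAffineQuadrangle.of_parallel_classes (T := K) (D := K × K) (Q := K × K × K)
    (fun d t v => (v.1 - t * d.1, v.2.1 - t * d.2, v.2.2 - t * (d.1 ^ 2 + d.2 ^ 2)))
    (by simp) ?_ ?_ ?_
  · simpa [sq] using this
  · rintro a t ⟨x, y⟩ ⟨x', y'⟩ h
    simpa [Prod.ext_iff] using h
  · rintro ⟨a, a'⟩ ⟨b, b'⟩ t t' ⟨x, y, z⟩ ⟨x', y', z'⟩ h₁ h₂
    simp only [Prod.mk.injEq] at h₁ h₂ ⊢
    have e₁ : (t - t') * (a - b) = 0 := by linear_combination h₂.1 - h₁.1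
    have e₂ : (t - t') * (a' - b') = 0 := by linear_combination h₂.2.1 - h₁.2.1
    simp only [mul_eq_zero, sub_eq_zero] at e₁ e₂
    tauto
  · rintro ⟨a, a'⟩ ⟨b, b'⟩ ⟨c, c'⟩ t₁ t₂ t₃ ⟨x₁, y₁, z₁⟩ ⟨x₂, y₂, z₂⟩ ⟨x₃, y₃, z₃⟩ h₁ h₂ h₃
    simp only [Prod.mk.injEq] at h₁ h₂ h₃ ⊢
    have e₁ : (t₁ - t₂) * (a - c) = -((t₂ - t₃) * (b - c)) := by
      linear_combination -h₁.1 - h₂.1 - h₃.1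
    have e₂ : (t₁ - t₂) * (a' - c') = -((t₂ - t₃) * (b' - c')) := by
      linear_combination -h₁.2.1 - h₂.2.1 - h₃.2.1
    have e₃ : (t₁ - t₂) * ((a - c) ^ 2 + (a' - c') ^ 2)
        + (t₂ - t₃) * ((b - c) ^ 2 + (b' - c') ^ 2) = 0 := by
      linear_combination -h₁.2.2 - h₂.2.2 - h₃.2.2 - 2 * c * e₁ - 2 * c' * e₂
    -- Taking norms in `e₁`, `e₂` compares `|a - c|²` with `|b - c|²`; together with `e₃` only one
    -- norm survives, and anisotropy applies to it.
    have e₄ : (t₂ - t₃) * (t₃ - t₁) * ((b - c) ^ 2 + (b' - c') ^ 2) = 0 := by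
      linear_combination -(t₁ - t₂) * e₃ + ((t₁ - t₂) * (a - c) - (t₂ - t₃) * (b - c)) * e₁
        + ((t₁ - t₂) * (a' - c') - (t₂ - t₃) * (b' - c')) * e₂
    rcases mul_eq_zero.1 e₄ with h | h
    · simp only [mul_eq_zero, sub_eq_zero] at h
      tauto
    · have := aniso _ _ h
      simp only [sub_eq_zero] at this
      tauto

/-- The points of a Hermitian variety in four-dimensional projective space over `K[i]` that are
not collinear with a given one, in real coordinates. -/
theorem existsAffineQuadrangle_hermitian
    (aniso : ∀ x y : K, x ^ 2 + y ^ 2 = 0 → x = 0 ∧ y = 0) :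
    ExistsAffineQuadrangle (Fintype.card K ^ 2) (Fintype.card K ^ 3) := by
  -- With `τ = t + i t'`, `A = a + i a'` and `M = -|A|² + i b`, the first four coordinates are the
  -- real and imaginary parts of `ξ - τ A` and `η - τ M`, where `ξ = x + i x'` and `η = y + i y'`.
  -- The fifth carries the imaginary part of the Hermitian form.
  have := ExistsAffineQuadrangle.of_parallel_classes (T := K × K) (D := K × K × K)
    (Q := K × K × K × K × K)
    (fun ⟨a, a', b⟩ ⟨t, t'⟩ ⟨x, x', y, y', z⟩ =>
      (x - (t * a - t' * a'), x' - (t * a' + t' * a),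
        y - (-t * (a ^ 2 + a' ^ 2) - t' * b), y' - (t * b - t' * (a ^ 2 + a' ^ 2)),
        z - (t' * (-t * (a ^ 2 + a' ^ 2) - t' * b) - t * (t * b - t' * (a ^ 2 + a' ^ 2))
          + (y' * t - y * t') + 2 * (x' * (t * a - t' * a') - x * (t * a' + t' * a)))))
    (by simp; ring) ?_ ?_ ?_
  · convert this using 1 <;> simp <;> ring
  · rintro ⟨a, a', b⟩ ⟨t, t'⟩ ⟨x, x', y, y', z⟩ ⟨x₂, x₂', y₂, y₂', z₂⟩ h
    simp only [Prod.mk.injEq, sub_left_inj] at h ⊢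
    obtain ⟨rfl, rfl, rfl, rfl, h⟩ := h
    simpa using h
  · rintro ⟨a, a', b⟩ ⟨c, c', d⟩ ⟨t, t'⟩ ⟨u, u'⟩ ⟨x, x', y, y', z⟩ ⟨x₂, x₂', y₂, y₂', z₂⟩ h k
    simp only [Prod.mk.injEq] at h k ⊢
    obtain ⟨h₁, h₂, h₃, h₄, -⟩ := h
    obtain ⟨k₁, k₂, k₃, k₄, -⟩ := k
    by_cases hs : (t - u) ^ 2 + (t' - u') ^ 2 = 0
    · have := aniso _ _ hs
      simp only [sub_eq_zero] at this
      exact Or.inl this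
    right
    have e₁ : ((t - u) ^ 2 + (t' - u') ^ 2) * (a - c) = 0 := by
      linear_combination (t - u) * (k₁ - h₁) + (t' - u') * (k₂ - h₂)
    have e₂ : ((t - u) ^ 2 + (t' - u') ^ 2) * (a' - c') = 0 := by
      linear_combination (t - u) * (k₂ - h₂) - (t' - u') * (k₁ - h₁)
    have e₃ : ((t - u) ^ 2 + (t' - u') ^ 2) * (b - d) = 0 := by
      linear_combination (t - u) * (k₄ - h₄) - (t' - u') * (k₃ - h₃)
    simp only [mul_eq_zero, hs, false_or, sub_eq_zero] at e₁ e₂ e₃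
    exact ⟨e₁, e₂, e₃⟩
  · rintro ⟨a, a', b⟩ ⟨c, c', d⟩ ⟨e, e', f⟩ ⟨t₁, t₁'⟩ ⟨t₂, t₂'⟩ ⟨t₃, t₃'⟩
      ⟨x₁, x₁', y₁, y₁', z₁⟩ ⟨x₂, x₂', y₂, y₂', z₂⟩ ⟨x₃, x₃', y₃, y₃', z₃⟩ h k l
    simp only [Prod.mk.injEq] at h k l ⊢
    obtain ⟨h₁, h₂, h₃, h₄, h₅⟩ := h
    obtain ⟨k₁, k₂, k₃, k₄, k₅⟩ := k
    obtain ⟨l₁, l₂, l₃, l₄, l₅⟩ := l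
    -- Added around the triangle, these three relations cancel the `z` coordinates and leave the
    -- last hypothesis of `hermitian_directions_eq`.
    have hz := collinear_of_hermitian_line h₁ h₂ h₃ h₄ h₅
    have kz := collinear_of_hermitian_line k₁ k₂ k₃ k₄ k₅
    have lz := collinear_of_hermitian_line l₁ l₂ l₃ l₄ l₅
    have := hermitian_directions_eq aniso (s := t₁ - t₂) (s' := t₁' - t₂')
      (w := t₂ - t₃) (w' := t₂' - t₃') (a := a) (a' := a') (b := b) (c := c) (c' := c')
      (d := d) (e := e) (e' := e') (f := f)
      (by linear_combination -h₁ - k₁ - l₁) (by linear_combination -h₂ - k₂ - l₂)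
      (by linear_combination -h₃ - k₃ - l₃) (by linear_combination -h₄ - k₄ - l₄) ?_
    · simp only [sub_eq_zero] at this
      tauto
    · clear l₁ l₂ l₃ l₄ l₅ h₅ k₅
      obtain rfl : x₂ = x₃ + ((t₂ - t₃) * c - (t₂' - t₃') * c') := by linear_combination k₁
      obtain rfl : x₂' = x₃' + ((t₂ - t₃) * c' + (t₂' - t₃') * c) := by linear_combination k₂
      obtain rfl : y₂ = y₃ + (-(t₂ - t₃) * (c ^ 2 + c' ^ 2) - (t₂' - t₃') * d) := by
        linear_combination k₃
      obtain rfl : y₂' = y₃' + ((t₂ - t₃) * d - (t₂' - t₃') * (c ^ 2 + c' ^ 2)) := by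
        linear_combination k₄
      obtain rfl := eq_add_of_sub_eq h₁
      obtain rfl := eq_add_of_sub_eq h₂
      obtain rfl := eq_add_of_sub_eq h₃
      obtain rfl := eq_add_of_sub_eq h₄
      linear_combination hz + kz + lz

end Constructions

/-- An odd power of 3 is 3 modulo 4, so `-1` is not a square in the field of that order and `x ^ 2 +
y ^ 2` is anisotropic. -/
theorem exists_affineQuadrangles (i : ℕ) :
    let q := 3 ^ (2 * i + 1)
    ExistsAffineQuadrangle q q ∧ ExistsAffineQuadrangle q (q ^ 2) ∧
      ExistsAffineQuadrangle (q ^ 2) (q ^ 3) := by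
  intro q
  have : Fact (Nat.Prime 3) := ⟨Nat.prime_three⟩
  let K := GaloisField 3 (2 * i + 1)
  have : Fintype K := Fintype.ofFinite K
  have card : Fintype.card K = q := by
    rw [← Nat.card_eq_fintype_card, GaloisField.card 3 _ (by omega)]
  have nonsq : ¬ IsSquare (-1 : K) := by
    rw [FiniteField.isSquare_neg_one_iff, card, not_not]
    simp only [q, pow_succ, pow_mul]
    rw [Nat.mul_mod, Nat.pow_mod]
    simp
  have aniso : ∀ x y : K, x ^ 2 + y ^ 2 = 0 → x = 0 ∧ y = 0 := by
    intro x y h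
    have hy : y = 0 := by
      by_contra hy
      refine nonsq ⟨x / y, ?_⟩
      rw [div_mul_div_comm, eq_div_iff (mul_ne_zero hy hy)]
      linear_combination -h
    subst hy
    simpa using h
  rw [← card]
  exact ⟨existsAffineQuadrangle_conic, existsAffineQuadrangle_quadric aniso,
    existsAffineQuadrangle_hermitian aniso⟩

/-! ### Random colourings of the lines -/

section RandomColouring

open Finset
open scoped Classical

/-- The probability `(τ / |C|) ^ #B` of independent constraints, with denominators cleared. -/
theorem card_functions_mem_mul {X C : Type*} [Fintype X] [DecidableEq X] [Fintype C]
    [DecidableEq C] (B : Finset X)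
    (T : X → Finset C) {τ : ℕ} (hT : ∀ x ∈ B, (T x).card = τ) :
    #{φ : X → C | ∀ x ∈ B, φ x ∈ T x} * Fintype.card C ^ #B
      = τ ^ #B * Fintype.card C ^ Fintype.card X := by
  have h₁ : ({φ : X → C | ∀ x ∈ B, φ x ∈ T x} : Finset (X → C))
      = Fintype.piFinset fun x => if x ∈ B then T x else univ := by
    ext φ
    simp only [mem_filter, mem_univ, true_and, Fintype.mem_piFinset]
    refine forall_congr' fun x => ?_
    split_ifs with hx <;> simp [hx]
  have h₂ : ∀ x, #(if x ∈ B then T x else univ) = if x ∈ B then τ else Fintype.card C := by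
    intro x
    split_ifs with hx
    · exact hT x hx
    · rfl
  rw [h₁, Fintype.card_piFinset, prod_congr rfl fun x _ => h₂ x, prod_ite, prod_const, prod_const,
    filter_mem_eq_inter, univ_inter, filter_not, filter_mem_eq_inter, univ_inter, mul_assoc,
    ← pow_add, ← compl_eq_univ_sdiff, add_comm, card_add_card_compl]

theorem card_functions_eq_mul {X C : Type*} [Fintype X] [DecidableEq X] [Fintype C]
    [DecidableEq C] {x y : X} (hxy : x ≠ y) :
    #{φ : X → C | φ x = φ y} * Fintype.card C ≤ Fintype.card C ^ Fintype.card X := by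
  rcases Nat.eq_zero_or_pos (Fintype.card C) with h0 | h0
  · simp [h0]
  have hsub : ({φ : X → C | φ x = φ y} : Finset (X → C)) ⊆
      univ.biUnion fun c => {φ : X → C | ∀ z ∈ ({x, y} : Finset X), φ z ∈ ({c} : Finset C)} := by
    intro φ hφ
    simp only [mem_filter, mem_univ, true_and] at hφ
    simp [hφ]
  have hc : ∀ c : C, #{φ : X → C | ∀ z ∈ ({x, y} : Finset X), φ z ∈ ({c} : Finset C)}
      * Fintype.card C ^ 2 = Fintype.card C ^ Fintype.card X := by
    intro c
    have := card_functions_mem_mul ({x, y} : Finset X) (fun _ => ({c} : Finset C)) (τ := 1)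
      (by simp)
    rwa [card_pair hxy, one_pow, one_mul] at this
  refine Nat.le_of_mul_le_mul_right (c := Fintype.card C) ?_ h0
  calc #{φ : X → C | φ x = φ y} * Fintype.card C * Fintype.card C
      ≤ (∑ c : C, #{φ : X → C | ∀ z ∈ ({x, y} : Finset X), φ z ∈ ({c} : Finset C)})
          * Fintype.card C ^ 2 := by
        rw [mul_assoc, ← sq]
        exact Nat.mul_le_mul_right _ ((card_le_card hsub).trans card_biUnion_le)
    _ = Fintype.card C ^ Fintype.card X * Fintype.card C := by
        rw [sum_mul, sum_congr rfl fun c _ => hc c]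
        simp [mul_comm]

/-- The union of complete multipartite graphs on the lines, where the parts of the line `l` are
the colour classes of `χ (l, ·)`. -/
def multipartiteOnLines {P L : Type} (I : P → L → Prop) {s : ℕ} (χ : L × P → Fin s) : SimpleGraph P where
  Adj p p' := ∃ l, I p l ∧ I p' l ∧ χ (l, p) ≠ χ (l, p')
  symm := ⟨fun _ _ ⟨l, h, h', hne⟩ => ⟨l, h', h, hne.symm⟩⟩
  loopless := ⟨fun _ ⟨_, _, _, hne⟩ => hne rfl⟩

/-- One point of each colour on a common line spans a `K_s`. -/
theorem card_lt_of_multipartiteOnLines_cliqueFree {P L : Type} {I : P → L → Prop}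
    {s m : ℕ} {χ : L × P → Fin s}
    (hχ : ∀ A : Finset P, #A = m → ∃ l, ∀ c, ∃ p ∈ A, I p l ∧ χ (l, p) = c) {S : Finset P}
    (hS : ((multipartiteOnLines I χ).induce (S : Set P)).CliqueFree s) : #S < m := by
  by_contra! hm
  obtain ⟨A, hAS, hA⟩ := exists_subset_card_eq hm
  obtain ⟨l, hl⟩ := hχ A hA
  choose f hfA hfI hfχ using hl
  refine SimpleGraph.cliqueFree_iff.1 hS |>.false
    ⟨⟨fun c => ⟨f c, hAS (hfA c)⟩, fun {c d} hcd => ?_⟩, fun c d hcd => ?_⟩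
  · refine ⟨l, hfI c, hfI d, fun h => ?_⟩
    change χ (l, f c) = χ (l, f d) at h
    revert h
    rw [hfχ, hfχ]
    simpa using hcd
  · have : f c = f d := congrArg Subtype.val hcd
    rw [← hfχ c, ← hfχ d, this]

variable {P L : Type} [Fintype P] [Fintype L]

/-- Union bound over the choice of a missing colour on every line. Once the choice is fixed, each of
the `#A * r` incidences at `A` independently avoids one colour. -/
theorem card_colourings_missing_le {I : P → L → Prop} {r : ℕ}
    (hr : ∀ p, Nat.card {l // I p l} = r) {s : ℕ} (hs : 2 ≤ s) (A : Finset P) :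
    (#{χ : L × P → Fin s | ∀ l, ∃ c, ∀ p ∈ A, I p l → χ (l, p) ≠ c} : ℝ) ≤
      (s : ℝ) ^ Fintype.card (L × P) *
        ((s : ℝ) ^ Fintype.card L * (1 - 1 / (s : ℝ)) ^ (#A * r)) := by
  set B : Finset (L × P) := {x | x.2 ∈ A ∧ I x.2 x.1} with hB
  have cardB : #B = #A * r := by
    have : B = (A.sigma fun p => ({l | I p l} : Finset L)).map
        ((Equiv.sigmaEquivProd P L).trans (Equiv.prodComm P L)).toEmbedding := by
      ext ⟨l, p⟩
      simp [hB]
    rw [this, card_map, card_sigma, sum_const_nat]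
    intro p _
    rw [← hr p, Nat.card_eq_fintype_card, Fintype.card_subtype]
  have hsub : ({χ : L × P → Fin s | ∀ l, ∃ c, ∀ p ∈ A, I p l → χ (l, p) ≠ c} :
      Finset (L × P → Fin s)) ⊆ univ.biUnion fun c : L → Fin s =>
        {χ : L × P → Fin s | ∀ x ∈ B, χ x ∈ univ.erase (c x.1)} := by
    intro χ hχ
    simp only [mem_filter, mem_univ, true_and] at hχ
    choose c hc using hχ
    simp only [mem_biUnion, mem_filter, mem_univ, true_and]
    refine ⟨c, fun x hx => ?_⟩
    simp only [hB, mem_filter, mem_univ, true_and] at hx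
    simpa using hc x.1 x.2 hx.1 hx.2
  have hc : ∀ c : L → Fin s,
      (#{χ : L × P → Fin s | ∀ x ∈ B, χ x ∈ univ.erase (c x.1)} : ℝ) =
        (s : ℝ) ^ Fintype.card (L × P) * (1 - 1 / (s : ℝ)) ^ (#A * r) := by
    intro c
    have h := card_functions_mem_mul B (fun x => univ.erase (c x.1)) (τ := s - 1)
      (by intro x _; simp)
    rw [Fintype.card_fin, cardB] at h
    have h' := congrArg (Nat.cast (R := ℝ)) h
    have hs0 : (s : ℝ) ≠ 0 := by positivity
    push_cast [Nat.cast_sub (show 1 ≤ s by omega)] at h'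
    rw [one_sub_div hs0, div_pow, ← mul_div_assoc, eq_div_iff (by positivity)]
    rw [h']
    ring
  calc (#{χ : L × P → Fin s | ∀ l, ∃ c, ∀ p ∈ A, I p l → χ (l, p) ≠ c} : ℝ)
      ≤ ∑ c : L → Fin s, (#{χ : L × P → Fin s | ∀ x ∈ B, χ x ∈ univ.erase (c x.1)} : ℝ) := by
        exact_mod_cast (card_le_card hsub).trans card_biUnion_le
    _ = _ := by
        rw [sum_congr rfl fun c _ => hc c, sum_const]
        simp
        ring

/-- The ordered pairs of distinct points on a common line, together with the line. -/
noncomputable def collinearTriples (I : P → L → Prop) : Finset (L × P × P) :=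
  {x | I x.2.1 x.1 ∧ I x.2.2 x.1 ∧ x.2.1 ≠ x.2.2}

theorem card_collinearTriples {I : P → L → Prop} {k : ℕ}
    (hk : ∀ l, Nat.card {p // I p l} = k) :
    #(collinearTriples I) = Fintype.card L * (k * k - k) := by
  have : collinearTriples I = ((univ : Finset L).sigma
      fun l => ({p | I p l} : Finset P).offDiag).map
        (Equiv.sigmaEquivProd L (P × P)).toEmbedding := by
    ext ⟨l, p, p'⟩
    simp [collinearTriples]
  rw [this, card_map, card_sigma, sum_const_nat, card_univ]
  intro l _
  rw [offDiag_card, ← hk l, Nat.card_eq_fintype_card, Fintype.card_subtype]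

/-- First moment method. On average at most half of the triples are monochromatic, and `hm` makes
the expected number of bad `m`-sets at most `1 / 4`. -/
theorem exists_good_colouring (I : P → L → Prop) {r : ℕ}
    (hr : ∀ p, Nat.card {l // I p l} = r) {s : ℕ} (hs : 2 ≤ s) {m : ℕ}
    (hT : (collinearTriples I).Nonempty)
    (hm : (Fintype.card P : ℝ) ^ m * ((s : ℝ) ^ Fintype.card L * (1 - 1 / (s : ℝ)) ^ (m * r))
      ≤ 1 / 4) :
    ∃ χ : L × P → Fin s,
      (∀ A : Finset P, #A = m → ∃ l, ∀ c, ∃ p ∈ A, I p l ∧ χ (l, p) = c) ∧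
      #(collinearTriples I) ≤
        4 * #{x ∈ collinearTriples I | χ (x.1, x.2.1) ≠ χ (x.1, x.2.2)} := by
  set Tr := collinearTriples I with hTr
  set Ω : ℝ := (s : ℝ) ^ Fintype.card (L × P) with hΩ
  have hs0 : (2 : ℝ) ≤ s := by exact_mod_cast hs
  have hΩ0 : 0 < Ω := by positivity
  have hT0 : (0 : ℝ) < #Tr := by exact_mod_cast hT.card_pos
  set bad : (L × P → Fin s) → Finset P → Prop :=
    fun χ A => ∀ l, ∃ c, ∀ p ∈ A, I p l → χ (l, p) ≠ c
  have sum_mono : ∑ χ : L × P → Fin s,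
      (#{x ∈ Tr | χ (x.1, x.2.1) = χ (x.1, x.2.2)} : ℝ) ≤ #Tr * Ω / 2 := by
    have h₁ : ∀ x ∈ Tr, (#{χ : L × P → Fin s | χ (x.1, x.2.1) = χ (x.1, x.2.2)} : ℝ) ≤ Ω / 2 := by
      intro x hx
      have hne : (x.1, x.2.1) ≠ (x.1, x.2.2) := by
        simp only [hTr, collinearTriples, mem_filter, mem_univ, true_and] at hx
        simpa using hx.2.2
      have := card_functions_eq_mul (C := Fin s) hne
      rw [Fintype.card_fin] at this
      have h' : (#{χ : L × P → Fin s | χ (x.1, x.2.1) = χ (x.1, x.2.2)} : ℝ) * s ≤ Ω := by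
        rw [hΩ]
        exact_mod_cast this
      rw [le_div_iff₀ two_pos]
      exact (mul_le_mul_of_nonneg_left hs0 (by positivity)).trans h'
    calc ∑ χ : L × P → Fin s, (#{x ∈ Tr | χ (x.1, x.2.1) = χ (x.1, x.2.2)} : ℝ)
        = ∑ x ∈ Tr, (#{χ : L × P → Fin s | χ (x.1, x.2.1) = χ (x.1, x.2.2)} : ℝ) := by
          simp only [card_filter, Nat.cast_sum]
          exact sum_comm
      _ ≤ ∑ x ∈ Tr, Ω / 2 := sum_le_sum h₁
      _ = #Tr * Ω / 2 := by rw [sum_const, nsmul_eq_mul]; ring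
  have sum_bad : ∑ χ : L × P → Fin s, (#{A ∈ powersetCard m univ | bad χ A} : ℝ) ≤ Ω / 4 := by
    calc ∑ χ : L × P → Fin s, (#{A ∈ powersetCard m univ | bad χ A} : ℝ)
        = ∑ A ∈ powersetCard m univ, (#{χ : L × P → Fin s | bad χ A} : ℝ) := by
          simp only [card_filter, Nat.cast_sum]
          exact sum_comm
      _ ≤ ∑ A ∈ powersetCard m (univ : Finset P),
            Ω * ((s : ℝ) ^ Fintype.card L * (1 - 1 / (s : ℝ)) ^ (m * r)) := by
          refine sum_le_sum fun A hA => ?_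
          have := card_colourings_missing_le hr hs A
          rwa [(mem_powersetCard.1 hA).2] at this
      _ ≤ Ω * ((Fintype.card P : ℝ) ^ m *
            ((s : ℝ) ^ Fintype.card L * (1 - 1 / (s : ℝ)) ^ (m * r))) := by
          rw [sum_const, card_powersetCard, card_univ, nsmul_eq_mul, ← mul_assoc, mul_comm _ Ω,
            mul_assoc]
          have : (0 : ℝ) ≤ 1 - 1 / s := by
            rw [sub_nonneg, div_le_one (by linarith)]
            linarith
          gcongr
          exact_mod_cast Nat.choose_le_pow _ _
      _ ≤ Ω * (1 / 4) := by gcongr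
      _ = Ω / 4 := by ring
  -- Each bad set is charged the weight `#Tr`, so the mean total is at most `(1 / 2 + 1 / 4) * #Tr`.
  -- A colouring not exceeding `3 / 4 * #Tr` has no bad set and at least a quarter of its triples
  -- bichromatic.
  obtain ⟨χ, -, hχ⟩ := exists_le_of_sum_le (s := (univ : Finset (L × P → Fin s)))
    (f := fun χ => (#{x ∈ Tr | χ (x.1, x.2.1) = χ (x.1, x.2.2)} : ℝ)
      + #Tr * (#{A ∈ powersetCard m (univ : Finset P) | bad χ A} : ℝ))
    (g := fun _ => #Tr * (3 / 4)) ⟨fun _ => ⟨0, by omega⟩, mem_univ _⟩ (by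
      rw [sum_add_distrib, ← mul_sum, sum_const, card_univ, Fintype.card_fun, Fintype.card_fin,
        nsmul_eq_mul, Nat.cast_pow, ← hΩ]
      have := mul_le_mul_of_nonneg_left sum_bad hT0.le
      linarith)
  have no_bad : #{A ∈ powersetCard m (univ : Finset P) | bad χ A} = 0 := by
    by_contra h
    have h1 : (1 : ℝ) ≤ #{A ∈ powersetCard m (univ : Finset P) | bad χ A} := by
      exact_mod_cast Nat.one_le_iff_ne_zero.2 h
    have h2 := mul_le_mul_of_nonneg_left h1 hT0.le
    have h3 : (0 : ℝ) ≤ #{x ∈ Tr | χ (x.1, x.2.1) = χ (x.1, x.2.2)} := by positivity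
    linarith
  refine ⟨χ, fun A hA => ?_, ?_⟩
  · by_contra! h
    have : A ∈ ({A ∈ powersetCard m (univ : Finset P) | bad χ A} : Finset _) :=
      mem_filter.2 ⟨mem_powersetCard.2 ⟨subset_univ _, hA⟩, h⟩
    rw [card_eq_zero.1 no_bad] at this
    exact absurd this (notMem_empty _)
  · rw [no_bad] at hχ
    have h := card_filter_add_card_filter_not (s := Tr)
      (fun x => χ (x.1, x.2.1) = χ (x.1, x.2.2))
    have h' : (#{x ∈ Tr | χ (x.1, x.2.1) = χ (x.1, x.2.2)} : ℝ)
      + #{x ∈ Tr | χ (x.1, x.2.1) ≠ χ (x.1, x.2.2)} = #Tr := by exact_mod_cast h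
    have : (#Tr : ℝ) ≤ 4 * #{x ∈ Tr | χ (x.1, x.2.1) ≠ χ (x.1, x.2.2)} := by
      simp only [Nat.cast_zero, mul_zero, add_zero] at hχ
      linarith
    exact_mod_cast this

/-- Triangle-freeness puts every vertex of a clique on the line joining two of them. By linearity no
other line can supply adjacencies there, so the colours on that line are distinct, and only `s` are
available. -/
theorem multipartiteOnLines_cliqueFree {I : P → L → Prop} {k r : ℕ}
    (h : IsAffineQuadrangle I k r) {s : ℕ} (hs : 2 ≤ s) (χ : L × P → Fin s) :
    (multipartiteOnLines I χ).CliqueFree (s + 1) := by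
  rw [SimpleGraph.cliqueFree_iff]
  refine ⟨fun f => ?_⟩
  have finj : ∀ i j, i ≠ j → f i ≠ f j := fun i j hij e => hij (f.injective e)
  have hadj : ∀ i j, i ≠ j → ∃ l, I (f i) l ∧ I (f j) l ∧ χ (l, f i) ≠ χ (l, f j) :=
    fun i j hij => f.toHom.map_adj (by simpa using hij)
  let i₀ : Fin (s + 1) := ⟨0, by omega⟩
  let i₁ : Fin (s + 1) := ⟨1, by omega⟩
  have h01 : i₀ ≠ i₁ := by simp [i₀, i₁]
  obtain ⟨l, hl₀, hl₁, hne⟩ := hadj i₀ i₁ h01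
  have on_line : ∀ i, I (f i) l := by
    intro i
    by_cases hi₀ : i = i₀
    · rwa [hi₀]
    by_cases hi₁ : i = i₁
    · rwa [hi₁]
    obtain ⟨l₁, h₁, h₁', -⟩ := hadj i₁ i (Ne.symm hi₁)
    obtain ⟨l₂, h₂, h₂', -⟩ := hadj i i₀ hi₀
    rcases h.triangle_free _ _ _ _ _ _ hl₀ hl₁ h₁ h₁' h₂ h₂' with e | e | e | e | e | e
    · exact absurd e (finj _ _ h01)
    · exact absurd e (finj _ _ (Ne.symm hi₁))
    · exact absurd e (finj _ _ hi₀)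
    · rwa [e]
    · subst e
      rcases h.linear _ _ _ _ hl₀ hl₁ h₂' h₁ with e | e
      · exact absurd e (finj _ _ h01)
      · rwa [e]
    · rwa [← e]
  have hinj : Function.Injective fun i => χ (l, f i) := by
    intro i j hij
    by_contra hne
    obtain ⟨l', h₁, h₂, h₃⟩ := hadj i j hne
    rcases h.linear _ _ _ _ (on_line i) (on_line j) h₁ h₂ with e | e
    · exact finj i j hne e
    · subst e
      exact h₃ hij
  have := Fintype.card_le_of_injective _ hinj
  simp at this

/-- Two distinct points determine their line, so the bichromatic triples inject into the darts. -/
theorem card_triples_le_twice_ncard_edgeSet {I : P → L → Prop} {k r : ℕ}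
    (h : IsAffineQuadrangle I k r) {s : ℕ} (χ : L × P → Fin s) :
    #{x ∈ collinearTriples I | χ (x.1, x.2.1) ≠ χ (x.1, x.2.2)} ≤
      2 * (multipartiteOnLines I χ).edgeSet.ncard := by
  rw [← SimpleGraph.coe_edgeFinset, Set.ncard_coe_finset, ← SimpleGraph.dart_card_eq_twice_card_edges,
    ← Fintype.card_coe]
  refine Fintype.card_le_of_injective (fun x => ⟨(x.1.2.1, x.1.2.2), ?_⟩) ?_
  · have := x.2
    simp only [collinearTriples, mem_filter, mem_univ, true_and] at this
    exact ⟨x.1.1, this.1.1, this.1.2.1, this.2⟩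
  · rintro ⟨⟨l, p, p'⟩, hx⟩ ⟨⟨l', q, q'⟩, hy⟩ e
    simp only [collinearTriples, mem_filter, mem_univ, true_and] at hx hy
    obtain ⟨rfl, rfl⟩ := Prod.mk.inj (congrArg SimpleGraph.Dart.toProd e)
    rcases h.linear _ _ _ _ hx.1.1 hx.1.2.1 hy.1.1 hy.1.2.1 with e | rfl
    · exact absurd e hx.1.2.2
    · rfl

theorem exists_graph_of_affineQuadrangle {k r s m : ℕ} (h : ExistsAffineQuadrangle k r)
    (hs : 2 ≤ s) (hk : 2 ≤ k) (hr : 1 ≤ r)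
    (hm : ((k ^ 2 * r : ℕ) : ℝ) ^ m * ((s : ℝ) ^ (k * r ^ 2) * (1 - 1 / (s : ℝ)) ^ (m * r))
      ≤ 1 / 4) :
    ∃ (V : Type) (_ : Fintype V) (G : SimpleGraph V), Fintype.card V = k ^ 2 * r ∧
      G.CliqueFree (s + 1) ∧
      (∀ S : Finset V, (G.induce (S : Set V)).CliqueFree s → #S < m) ∧
      k ^ 3 * r ^ 2 ≤ 16 * G.edgeSet.ncard := by
  obtain ⟨P, L, _, _, I, hI⟩ := h
  have hcard := card_collinearTriples hI.card_on_line
  rw [hI.card_lines] at hcard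
  have hkk : k * k ≤ 2 * (k * k - k) := by
    have : 2 * k ≤ k * k := Nat.mul_le_mul_right k hk
    omega
  have hlow : k ^ 3 * r ^ 2 ≤ 2 * #(collinearTriples I) := by
    rw [hcard]
    calc k ^ 3 * r ^ 2 = k * r ^ 2 * (k * k) := by ring
      _ ≤ k * r ^ 2 * (2 * (k * k - k)) := Nat.mul_le_mul_left _ hkk
      _ = _ := by ring
  obtain ⟨χ, hχ, hedges⟩ := exists_good_colouring I hI.card_through_point hs (m := m)
    (card_pos.1 (by have : 0 < k ^ 3 * r ^ 2 := by positivity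
                    omega))
    (by rwa [hI.card_points, hI.card_lines])
  have hE := card_triples_le_twice_ncard_edgeSet hI χ
  exact ⟨P, inferInstance, multipartiteOnLines I χ, hI.card_points,
    multipartiteOnLines_cliqueFree hI hs χ,
    fun S hS => card_lt_of_multipartiteOnLines_cliqueFree hχ hS, by omega⟩

end RandomColouring

/-! ### Ramsey–Turán numbers, blow-ups and the choice of scale -/

section RamseyTuran

open Finset

theorem sIndepNum_le {V : Type*} [Fintype V] {s b : ℕ} {G : SimpleGraph V}
    (h : ∀ S : Finset V, (G.induce (S : Set V)).CliqueFree s → #S ≤ b) : sIndepNum s G ≤ b := by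
  refine csSup_le' ?_
  rintro _ ⟨S, hS, rfl⟩
  exact h S hS

theorem card_le_sIndepNum {V : Type*} [Fintype V] {s : ℕ} {G : SimpleGraph V} {S : Finset V}
    (h : (G.induce (S : Set V)).CliqueFree s) : #S ≤ sIndepNum s G := by
  refine le_csSup ⟨Fintype.card V, ?_⟩ ⟨S, h, rfl⟩
  rintro _ ⟨S, -, rfl⟩
  exact card_le_univ S

theorem ncard_edgeSet_le_ramseyTuran {s n : ℕ} {f : ℝ} {G : SimpleGraph (Fin n)}
    (hG : G.CliqueFree (s + 1)) (hf : (sIndepNum s G : ℝ) < f) :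
    G.edgeSet.ncard ≤ ramseyTuran s n (⊤ : SimpleGraph (Fin (s + 1))) f := by
  refine le_csSup ?_ ⟨G, ?_, hf, rfl⟩
  · refine ((Set.finite_range fun G : SimpleGraph (Fin n) => G.edgeSet.ncard).subset ?_).bddAbove
    rintro _ ⟨G, -, -, rfl⟩
    exact ⟨G, rfl⟩
  · simpa using SimpleGraph.cliqueFree_iff_top_free (β := Fin (s + 1)) |>.1 (by simpa using hG)

/-- The neighbourhood of a vertex is `K_s`-free, so every degree is at most `α_s`. -/
theorem ramseyTuran_le {s n : ℕ} {f : ℝ} (hf : 0 ≤ f) :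
    (ramseyTuran s n (⊤ : SimpleGraph (Fin (s + 1))) f : ℝ) ≤ n * f := by
  classical
  -- An integer bound allows `csSup_le'`, which also covers the case of no admissible graph, where
  -- the supremum is `0`.
  suffices h : ramseyTuran s n (⊤ : SimpleGraph (Fin (s + 1))) f ≤ ⌊n * f⌋₊ from
    (Nat.cast_le.2 h).trans (Nat.floor_le (by positivity))
  refine csSup_le' ?_
  rintro _ ⟨G, hG, hα, rfl⟩
  refine Nat.le_floor ?_
  have hfree : G.CliqueFree (s + 1) := by
    simpa using SimpleGraph.cliqueFree_iff_top_free.2 hG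
  have hdeg : ∀ v, G.degree v ≤ sIndepNum s G := by
    intro v
    refine card_le_sIndepNum ((SimpleGraph.cliqueFree_induce_iff _ _ _).2 ?_)
    have := SimpleGraph.CliqueFreeOn.of_succ G (hfree.cliqueFreeOn (s := Set.univ)) (Set.mem_univ v)
    simpa using this
  have hsum : G.edgeSet.ncard ≤ n * sIndepNum s G := by
    rw [← SimpleGraph.coe_edgeFinset, Set.ncard_coe_finset]
    have := G.sum_degrees_eq_twice_card_edges
    have h2 := sum_le_sum fun v (_ : v ∈ univ) => hdeg v
    rw [sum_const, card_univ, Fintype.card_fin, smul_eq_mul] at h2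
    omega
  calc (G.edgeSet.ncard : ℝ) ≤ n * sIndepNum s G := by exact_mod_cast hsum
    _ ≤ n * f := by gcongr

theorem SimpleGraph.CliqueFree.comap_fun {V W : Type*} {G : SimpleGraph V} {s : ℕ}
    (h : G.CliqueFree s) (g : W → V) : (G.comap g).CliqueFree s := by
  rw [SimpleGraph.cliqueFree_iff] at h ⊢
  refine ⟨fun c => h.false ⟨⟨fun i => g (c i), fun hij => c.toHom.map_adj hij⟩, fun i j hij => ?_⟩⟩
  by_contra hne
  have : G.Adj (g (c i)) (g (c j)) := c.toHom.map_adj (show (⊤ : SimpleGraph _).Adj i j from hne)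
  exact this.ne hij

theorem SimpleGraph.CliqueFree.induce_image {V W : Type*} [DecidableEq V] {G : SimpleGraph V}
    {s : ℕ} {g : W → V} {S : Finset W} (h : ((G.comap g).induce (S : Set W)).CliqueFree s) :
    (G.induce (S.image g : Set V)).CliqueFree s := by
  rw [SimpleGraph.cliqueFree_iff] at h ⊢
  refine ⟨fun c => ?_⟩
  have hc : ∀ i, ∃ w ∈ S, g w = c i := fun i => by simpa using (c i).2
  choose w hwS hw using hc
  refine h.false ⟨⟨fun i => ⟨w i, hwS i⟩, fun {i j} hij => ?_⟩, fun i j hij => ?_⟩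
  · have : G.Adj (c i) (c j) := c.toHom.map_adj hij
    rw [← hw, ← hw] at this
    exact this
  · have : w i = w j := congrArg Subtype.val hij
    exact c.injective (Subtype.ext ((hw i).symm.trans (this ▸ hw j)))

/-- Vertices are replaced by independent classes of size at most `B`, the residue classes modulo
`Fintype.card V`. A set whose image has fewer than `m` vertices has at most `B * (m - 1)` elements,
and the original graph embeds in the blow-up. -/
theorem exists_blowup {V : Type} [Fintype V] (G : SimpleGraph V) {s m n B : ℕ}
    (hs : 1 ≤ s) (hfree : G.CliqueFree (s + 1))
    (hindep : ∀ S : Finset V, (G.induce (S : Set V)).CliqueFree s → #S < m)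
    (hN : 0 < Fintype.card V) (hn : Fintype.card V ≤ n) (hB : n < B * Fintype.card V) :
    ∃ G' : SimpleGraph (Fin n), G'.CliqueFree (s + 1) ∧ sIndepNum s G' < B * m ∧
      G.edgeSet.ncard ≤ G'.edgeSet.ncard := by
  classical
  let e := Fintype.equivFin V
  let g : Fin n → V := fun j => e.symm ⟨j % Fintype.card V, Nat.mod_lt _ hN⟩
  let σ : V ↪ Fin n := e.toEmbedding.trans (Fin.castLEEmb hn)
  have hgσ : ∀ v, g (σ v) = v := by
    intro v
    simp [g, σ, Nat.mod_eq_of_lt]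
  have hB0 : 0 < B := Nat.pos_of_ne_zero fun h => by simp [h] at hB
  have hm : 0 < m := by
    have := hindep ∅ ((SimpleGraph.cliqueFree_induce_iff _ _ _).2 (by simp; omega))
    omega
  refine ⟨G.comap g, hfree.comap_fun g, ?_, ?_⟩
  · have : sIndepNum s (G.comap g) ≤ B * (m - 1) := by
      refine sIndepNum_le fun S hS => ?_
      have himage : #(S.image g) < m := hindep _ hS.induce_image
      refine (card_le_mul_card_image (f := g) S B fun v _ => ?_).trans
        (Nat.mul_le_mul_left _ (by omega))
      rw [← card_range B]
      refine card_le_card_of_injOn (fun j => j.1 / Fintype.card V) (fun j _ => ?_)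
        fun i hi j hj hij => ?_
      · simp only [coe_range, Set.mem_Iio]
        exact (Nat.div_lt_iff_lt_mul hN).2 (j.2.trans hB)
      · simp only [coe_filter, Set.mem_ofPred_eq] at hi hj hij
        have h := e.symm.injective (hi.2.trans hj.2.symm)
        simp only [Fin.mk.injEq] at h
        refine Fin.ext ?_
        rw [← Nat.div_add_mod i.1 (Fintype.card V), hij, h, Nat.div_add_mod]
    refine this.trans_lt ?_
    exact Nat.mul_lt_mul_of_pos_left (by omega) hB0
  · let φ : G ↪g G.comap g := ⟨σ, fun {u v} => by simp [hgσ]⟩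
    rw [← Nat.card_coe_set_eq, ← Nat.card_coe_set_eq]
    exact Finite.card_le_of_embedding φ.mapEdgeSet

/-- With `m = 4 * s ^ 2 * k * r`, the three factors are at most `exp(s k r²)`, `exp(s k r²)` and
`exp(-4 s k r²)`. The first estimate needs `k ^ 2 * r ≤ exp(r / (4 s))`, which holds for large `q`
because `r ≥ q` and the left side is polynomial in `q`. -/
theorem eventually_union_bound (s : ℕ) (hs : 2 ≤ s) {α β : ℕ} (hβ : 1 ≤ β) :
    ∃ Q : ℕ, ∀ q : ℕ, Q ≤ q →
      (((q ^ α) ^ 2 * q ^ β : ℕ) : ℝ) ^ (4 * s ^ 2 * (q ^ α * q ^ β)) *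
        ((s : ℝ) ^ (q ^ α * (q ^ β) ^ 2) *
          (1 - 1 / (s : ℝ)) ^ (4 * s ^ 2 * (q ^ α * q ^ β) * q ^ β)) ≤ 1 / 4 := by
  have hs0 : (0 : ℝ) < s := by positivity
  have hev : ∀ᶠ q : ℕ in Filter.atTop,
      (q : ℝ) ^ (2 * α + β) ≤ Real.exp (1 / (4 * s) * q) := by
    have := (isLittleO_pow_exp_pos_mul_atTop (2 * α + β)
      (show (0 : ℝ) < 1 / (4 * s) by positivity)).bound one_pos
    filter_upwards [tendsto_natCast_atTop_atTop.eventually this] with q hq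
    rw [Real.norm_of_nonneg (by positivity), Real.norm_of_nonneg (Real.exp_pos _).le,
      one_mul] at hq
    exact hq
  obtain ⟨Q, hQ⟩ := Filter.eventually_atTop.1 (hev.and (Filter.eventually_ge_atTop 1))
  refine ⟨Q, fun q hq => ?_⟩
  obtain ⟨h₁, hq1⟩ := hQ q hq
  set k := q ^ α with hk
  set r := q ^ β with hr
  have hk1 : 1 ≤ k := Nat.one_le_pow _ _ hq1
  have hr1 : 1 ≤ r := Nat.one_le_pow _ _ hq1
  have hqr : (q : ℝ) ≤ r := by
    exact_mod_cast Nat.le_self_pow (by omega) q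
  set m := 4 * s ^ 2 * (k * r) with hm
  have hN : ((k ^ 2 * r : ℕ) : ℝ) ≤ Real.exp (r / (4 * s)) := by
    calc ((k ^ 2 * r : ℕ) : ℝ) = (q : ℝ) ^ (2 * α + β) := by
          rw [hk, hr]
          push_cast
          ring
      _ ≤ Real.exp (1 / (4 * s) * q) := h₁
      _ ≤ Real.exp (r / (4 * s)) := by
          rw [Real.exp_le_exp, div_mul_eq_mul_div, one_mul]
          gcongr
  have hsexp : (s : ℝ) ≤ Real.exp s := by linarith [Real.add_one_le_exp (s : ℝ)]
  have hmiss : 1 - 1 / (s : ℝ) ≤ Real.exp (-(1 / s)) := by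
    linarith [Real.add_one_le_exp (-(1 / (s : ℝ)))]
  have hmiss0 : 0 ≤ 1 - 1 / (s : ℝ) := by
    rw [sub_nonneg, div_le_one hs0]
    exact_mod_cast (by omega : 1 ≤ s)
  calc ((k ^ 2 * r : ℕ) : ℝ) ^ m * ((s : ℝ) ^ (k * r ^ 2) * (1 - 1 / (s : ℝ)) ^ (m * r))
      ≤ Real.exp (r / (4 * s)) ^ m *
          (Real.exp s ^ (k * r ^ 2) * Real.exp (-(1 / s)) ^ (m * r)) := by gcongr
    _ = Real.exp (-(2 * s * (k * r ^ 2))) := by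
        rw [← Real.exp_nat_mul, ← Real.exp_nat_mul, ← Real.exp_nat_mul, ← Real.exp_add,
          ← Real.exp_add, hm]
        congr 1
        push_cast
        field_simp
        ring
    _ ≤ Real.exp (-4) := by
        rw [Real.exp_le_exp, neg_le_neg_iff]
        have h2 : (2 : ℝ) ≤ s := by exact_mod_cast hs
        have h3 : (1 : ℝ) ≤ k * r ^ 2 := by
          exact_mod_cast Nat.one_le_iff_ne_zero.2 (by positivity)
        nlinarith
    _ ≤ 1 / 4 := by
        rw [Real.exp_neg, inv_eq_one_div]
        have := Real.add_one_le_exp (4 : ℝ)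
        gcongr
        linarith

/-- Consecutive odd powers of 3 have ratio 9. If no scale worked, the lower inequality would
propagate to all larger `i`, contradicting unboundedness. -/
theorem exists_pow_scale (D : ℕ) (hD : 1 ≤ D) (i₀ n : ℕ) (hn : (3 ^ (2 * i₀ + 1)) ^ D ≤ n) :
    ∃ i, i₀ ≤ i ∧ (3 ^ (2 * i + 1)) ^ D ≤ n ∧ n < 9 ^ D * (3 ^ (2 * i + 1)) ^ D := by
  by_contra! h
  have hall : ∀ i, i₀ ≤ i → (3 ^ (2 * i + 1)) ^ D ≤ n := by
    intro i hi
    induction i, hi using Nat.le_induction with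
    | base => exact hn
    | succ i hi ih =>
      refine le_of_eq_of_le ?_ (h i hi ih)
      rw [← mul_pow]
      congr 1
      ring
  have h₁ := hall (i₀ + n) (by omega)
  have h₂ : 2 * (i₀ + n) + 1 < 3 ^ (2 * (i₀ + n) + 1) := Nat.lt_pow_self (by norm_num)
  have h₃ : 3 ^ (2 * (i₀ + n) + 1) ≤ (3 ^ (2 * (i₀ + n) + 1)) ^ D :=
    Nat.le_self_pow (by omega) _
  omega

theorem ramseyTuran_bounds_of_affineQuadrangles {s : ℕ} (hs : 2 ≤ s) {α β : ℕ} (hα : 1 ≤ α)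
    (hβ : 1 ≤ β)
    (h : ∀ i : ℕ, ExistsAffineQuadrangle ((3 ^ (2 * i + 1)) ^ α) ((3 ^ (2 * i + 1)) ^ β))
    {δ : ℝ} (hδ : δ * (2 * α + β) = α + β) :
    ∃ C₀ : ℝ, 0 < C₀ ∧ ∃ a : ℝ, 0 < a ∧ ∃ n₀ : ℕ,
      ∀ C₁ : ℝ, C₀ ≤ C₁ → ∃ b : ℝ, 0 < b ∧
        ∀ n : ℕ, n₀ ≤ n → ∀ f : ℝ, C₀ * (n : ℝ) ^ δ ≤ f → f ≤ C₁ * (n : ℝ) ^ δ →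
          a * (n : ℝ) ^ (1 + δ) ≤ (ramseyTuran s n (⊤ : SimpleGraph (Fin (s + 1))) f : ℝ) ∧
          (ramseyTuran s n (⊤ : SimpleGraph (Fin (s + 1))) f : ℝ) ≤ b * (n : ℝ) ^ (1 + δ) := by
  have hα' : (1 : ℝ) ≤ α := by exact_mod_cast hα
  have hβ' : (1 : ℝ) ≤ β := by exact_mod_cast hβ
  have hδ0 : 0 < δ := by
    by_contra! h0
    nlinarith
  set D := 2 * α + β with hD
  set B : ℕ := 9 ^ D with hB
  have hB0 : (0 : ℝ) < B := by positivity
  obtain ⟨Q, hQ⟩ := eventually_union_bound s hs (α := α) hβ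
  -- The blow-up has `α_s` below `B * 4 * s ^ 2 * (q ^ D) ^ δ`, whence `C₀`. The constant `a`
  -- combines the edge loss `16` with `n ≤ B * q ^ D`, and `b = C₁` comes from the bound `n * f`.
  -- The choice of `n₀` guarantees `i ≥ Q`, hence `q ≥ Q`.
  refine ⟨B * (4 * s ^ 2), by positivity, 1 / (16 * (B : ℝ) ^ (1 + δ)), by positivity,
    (3 ^ (2 * Q + 1)) ^ D, fun C₁ hC₁ => ⟨C₁, lt_of_lt_of_le (by positivity) hC₁, ?_⟩⟩
  intro n hn f hf₀ hf₁
  have hn0 : (0 : ℝ) < n := by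
    have : 0 < (3 ^ (2 * Q + 1)) ^ D := by positivity
    exact_mod_cast this.trans_le hn
  have hf : 0 ≤ f := le_trans (by positivity) hf₀
  refine ⟨?_, ?_⟩
  · obtain ⟨i, hi, hNn, hnN⟩ := exists_pow_scale D (by omega) Q n hn
    set q := 3 ^ (2 * i + 1) with hq
    have hq0 : 0 < q := by positivity
    have hqi : 2 * i + 1 < q := Nat.lt_pow_self (by norm_num)
    have hq2 : 2 ≤ q ^ α := le_trans (by omega) (Nat.le_self_pow (by omega) q)
    obtain ⟨V, _, G, hV, hfree, hindep, hedges⟩ :=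
      exists_graph_of_affineQuadrangle (h i) hs hq2 (Nat.one_le_pow _ _ hq0)
        (hQ q (by omega))
    have hV' : Fintype.card V = q ^ D := by rw [hV, hD]; ring
    obtain ⟨G', hfree', hindep', hedges'⟩ := exists_blowup G (by omega) hfree hindep
      (by rw [hV']; positivity) (hV' ▸ hNn) (hV' ▸ hnN)
    have hqδ : ((q : ℝ) ^ D) ^ δ = (q : ℝ) ^ (α + β) := by
      rw [← Real.rpow_natCast, ← Real.rpow_natCast, ← Real.rpow_mul (by positivity)]
      congr 1
      rw [hD]
      push_cast
      linarith
    have hNn' : (q : ℝ) ^ D ≤ n := by exact_mod_cast hNn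
    have hnN' : (n : ℝ) ≤ B * (q : ℝ) ^ D := by exact_mod_cast hnN.le
    have hα_lt : (sIndepNum s G' : ℝ) < f := by
      calc (sIndepNum s G' : ℝ) < B * (4 * s ^ 2 * (q ^ α * q ^ β)) := by
            exact_mod_cast hindep'
        _ = B * (4 * s ^ 2) * ((q : ℝ) ^ D) ^ δ := by rw [hqδ]; ring
        _ ≤ B * (4 * s ^ 2) * (n : ℝ) ^ δ := by gcongr
        _ ≤ f := hf₀
    have hRT := ncard_edgeSet_le_ramseyTuran hfree' hα_lt
    have hE : ((q : ℝ) ^ D) ^ (1 + δ) ≤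
        16 * (ramseyTuran s n (⊤ : SimpleGraph (Fin (s + 1))) f : ℝ) := by
      rw [Real.rpow_add (by positivity), Real.rpow_one, hqδ]
      calc (q : ℝ) ^ D * (q : ℝ) ^ (α + β) = ((q ^ α) ^ 3 * (q ^ β) ^ 2 : ℕ) := by
            rw [hD]
            push_cast
            ring
        _ ≤ _ := by exact_mod_cast hedges.trans (Nat.mul_le_mul_left _ (hedges'.trans hRT))
    calc 1 / (16 * (B : ℝ) ^ (1 + δ)) * (n : ℝ) ^ (1 + δ)
        ≤ 1 / (16 * (B : ℝ) ^ (1 + δ)) * (B * (q : ℝ) ^ D) ^ (1 + δ) := by gcongr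
      _ = 1 / 16 * ((q : ℝ) ^ D) ^ (1 + δ) := by
          rw [Real.mul_rpow (by positivity) (by positivity)]
          have : (B : ℝ) ^ (1 + δ) ≠ 0 := by positivity
          field_simp
      _ ≤ _ := by linarith
  · calc (ramseyTuran s n (⊤ : SimpleGraph (Fin (s + 1))) f : ℝ) ≤ n * f := ramseyTuran_le hf
      _ ≤ n * (C₁ * (n : ℝ) ^ δ) := by gcongr
      _ = C₁ * (n : ℝ) ^ (1 + δ) := by
          rw [Real.rpow_add hn0, Real.rpow_one]
          ring

end RamseyTuran

theorem corollary6p3 (s : ℕ) (hs : 2 ≤ s) (δ : ℝ)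
    (hδ : δ ∈ ({3 / 5, 5 / 8, 2 / 3, 5 / 7, 3 / 4} : Set ℝ)) :
    ∃ C₀ : ℝ, 0 < C₀ ∧ ∃ a : ℝ, 0 < a ∧ ∃ n₀ : ℕ,
      ∀ C₁ : ℝ, C₀ ≤ C₁ → ∃ b : ℝ, 0 < b ∧
        ∀ n : ℕ, n₀ ≤ n → ∀ f : ℝ, C₀ * (n : ℝ) ^ δ ≤ f → f ≤ C₁ * (n : ℝ) ^ δ →
          a * (n : ℝ) ^ (1 + δ) ≤ (ramseyTuran s n (⊤ : SimpleGraph (Fin (s + 1))) f : ℝ) ∧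
          (ramseyTuran s n (⊤ : SimpleGraph (Fin (s + 1))) f : ℝ) ≤ b * (n : ℝ) ^ (1 + δ) := by
  simp only [Set.mem_insert_iff, Set.mem_singleton_iff] at hδ
  rcases hδ with rfl | rfl | rfl | rfl | rfl
  · exact ramseyTuran_bounds_of_affineQuadrangles hs (α := 2) (β := 1) (by norm_num) (by norm_num)
      (fun i => by simpa using (exists_affineQuadrangles i).2.1.dual) (by norm_num)
  · exact ramseyTuran_bounds_of_affineQuadrangles hs (α := 3) (β := 2) (by norm_num) (by norm_num)
      (fun i => (exists_affineQuadrangles i).2.2.dual) (by norm_num)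
  · exact ramseyTuran_bounds_of_affineQuadrangles hs (α := 1) (β := 1) (by norm_num) (by norm_num)
      (fun i => by simpa using (exists_affineQuadrangles i).1) (by norm_num)
  · exact ramseyTuran_bounds_of_affineQuadrangles hs (α := 2) (β := 3) (by norm_num) (by norm_num)
      (fun i => (exists_affineQuadrangles i).2.2) (by norm_num)
  · exact ramseyTuran_bounds_of_affineQuadrangles hs (α := 1) (β := 2) (by norm_num) (by norm_num)
      (fun i => by simpa using (exists_affineQuadrangles i).2.1) (by norm_num)
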